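/- All rings are associative with unity and bimodules are unital, unless stated otherwise. Let $n>1$ and let $$T=\begin{bmatrix}T_1&M_{12}&\cdots&M_{1n}\\ M_{21}&T_2&\cdots&M_{2n}\\ \vdots&&\ddots&\vdots\\ M_{n1}&\cdots&M_{n,n-1}&T_n\end{bmatrix}$$ be an $n$-by-$n$ generalized (formal) matrix ring: the $T_i$ are rings, the $M_{ij}$ are $(T_i,T_j)$-bimodules (with $M_{ii}=T_i$), and there are $(T_i,T_k)$-bimodule homomorphisms $\theta_{ijk}:M_{ij}\otimes_{T_j}M_{jk}\to M_{ik}$, where $\theta_{iii}$ is the multiplication of $T_i$ and $\theta_{iij},\theta_{ijj}$ are the scalar multiplications, which satisfy the associativity relation $(m_{ij}m_{jk})m_{kl}=m_{ij}(m_{jk}m_{kl})$ for all $i,j,k,l$; addition is componentwise and multiplication is row-column multiplication. Assume that $T\in\mathcal T_n$, i.e. $\theta_{iji}=0$ for all $i\neq j$. Let $\mathcal D(T)=\{[t_{ij}]\in T : t_{ij}=0 \text{ for all } i\ne j\}$, and for $1\le k\le n$ let $$\mathcal E_k=\{[t_{ij}]\in T : t_{kk}=1\in T_k,\ t_{kj}\in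 M_{kj}\text{ for } j\ne k,\ \text{and all other entries are zero}\}.$$ Then: 1. Every element $e$ of $\mathcal E=\bigcup_{k=1}^n\mathcal E_k$ is an inner Peirce trivial idempotent of $T$, that is, $e=e^2$ and $exye=exeye$ for all $x,y\in T$; and the subring of $T$ generated by $\mathcal D(T)\cup\mathcal E$ is $T$. 2. Let $\mathcal C$ be a (necessarily isomorphism-invariant) property of rings such that a ring $A$ has $\mathcal C$ if and only if $A/P$ has $\mathcal C$ for every prime ideal $P$ of $A$. Then $\mathcal D(T)$ has property $\mathcal C$ if and only if $T$ has property $\mathcal C$. 3. $\rho(\mathcal D(T))=\rho(T)\cap\mathcal D(T)$ for every special radical $\rho$. Here a special class is an isomorphism-closed class of prime rings (not necessarily with unity) that contains every ideal of each of its members and contains every ring having an essential ideal in the class; a special radical is the upper radical determined by a special class $\mathcal M$, i.e. $\rho(A)$ is the sum of all ideals $I$ of $A$ such that the ring $I$ has no nonzero homomorphic image in $\mathcal M$. 4. $\mathcal D(T)$ and $T$ have the same classical Krull dimension. This holds both for the supremum of the lengths of chains of prime ideals and for the ordinal-valued classical Krull dimension: let $\mathrm{Spec}_{-1}(A)=\emptyset$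 and, for ordinals $\alpha\ge 0$, let $\mathrm{Spec}_\alpha(A)$ be the set of prime ideals $P$ such that every prime ideal $Q\supsetneq P$ lies in $\mathrm{Spec}_\beta(A)$ for some $\beta<\alpha$; this dimension of $A$ is the least $\alpha\geq -1$ for which $\mathrm{Spec}_\alpha(A)$ contains all prime ideals of $A$, if such an $\alpha$ exists, and it exists for $\mathcal D(T)$ if and only if it exists for $T$. -/

import Mathlib

universe u

/-- The data of an `n`-by-`n` generalized (formal) matrix ring, with the convention `M i i = R i`:
an additive group `M i j` for all `i j`, biadditive products `M i j × M j k → M i k`, and units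
`one i ∈ M i i`, subject to associativity for all `i j k l` and to the unit laws.

This is the same as giving rings `R i`, unital `(R i, R j)`-bimodules `M i j` and
`(R i, R k)`-bimodule homomorphisms `θ i j k : M i j ⊗[R j] M j k → M i k` satisfying the
associativity relation, where `θ i i i` is the multiplication of `R i`, and `θ i i j`, `θ i j j` are
the scalar multiplications: a group homomorphism out of the tensor product over `R j` is a biadditive
map that is balanced over `R j`; the ring and bimodule laws, the balancedness and the bilinearity
are the cases of associativity in which some consecutive indices coincide (see `diagRing`,
`leftModule`, `rightModule`, `smulComm` below). -/
structure GenMatrixData (n : ℕ) where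
  M : Fin n → Fin n → Type u
  [grp : ∀ i j, AddCommGroup (M i j)]
  mul : ∀ i j k, M i j →+ M j k →+ M i k
  one : ∀ i, M i i
  mul_assoc : ∀ (i j k l : Fin n) (a : M i j) (b : M j k) (c : M k l),
    mul i k l (mul i j k a b) c = mul i j l a (mul j k l b c)
  one_mul : ∀ (i j : Fin n) (a : M i j), mul i i j (one i) a = a
  mul_one : ∀ (i j : Fin n) (a : M i j), mul i j j a (one j) = a

namespace GenMatrixData

variable {n : ℕ} (G : GenMatrixData.{u} n)

instance (i j : Fin n) : AddCommGroup (G.M i j) := G.grp i j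

/-- The diagonal ring `R i = M i i`. -/
@[reducible] def diagRing (i : Fin n) : Ring (G.M i i) :=
  { G.grp i i with
    mul := fun a b => G.mul i i i a b
    one := G.one i
    mul_assoc := G.mul_assoc i i i i
    one_mul := G.one_mul i i
    mul_one := G.mul_one i i
    left_distrib := fun a b c => map_add (G.mul i i i a) b c
    right_distrib := fun a b c => by
      change G.mul i i i (a + b) c = G.mul i i i a c + G.mul i i i b c
      rw [map_add, AddMonoidHom.add_apply]
    zero_mul := fun a => by
      change G.mul i i i 0 a = 0
      rw [map_zero, AddMonoidHom.zero_apply]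
    mul_zero := fun a => map_zero (G.mul i i i a)
    zsmul := (G.grp i i).zsmul }

/-- `M i j` as a left module over `R i`. -/
@[reducible] def leftModule (i j : Fin n) :
    @Module (G.M i i) (G.M i j) (G.diagRing i).toSemiring _ :=
  letI := G.diagRing i
  { smul := fun r a => G.mul i i j r a
    one_smul := G.one_mul i j
    mul_smul := fun r s a => G.mul_assoc i i i j r s a
    smul_zero := fun r => map_zero (G.mul i i j r)
    smul_add := fun r a b => map_add (G.mul i i j r) a b
    add_smul := fun r s a => by
      change G.mul i i j (r + s) a = G.mul i i j r a + G.mul i i j s a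
      rw [map_add, AddMonoidHom.add_apply]
    zero_smul := fun a => by
      change G.mul i i j 0 a = 0
      rw [map_zero, AddMonoidHom.zero_apply] }

/-- `M i j` as a right module over `R j`. -/
@[reducible] def rightModule (i j : Fin n) :
    letI := G.diagRing j
    Module (G.M j j)ᵐᵒᵖ (G.M i j) :=
  letI := G.diagRing j
  { smul := fun r a => G.mul i j j a r.unop
    one_smul := G.mul_one i j
    mul_smul := fun r s a => (G.mul_assoc i j j j a s.unop r.unop).symm
    smul_zero := fun r => by
      change G.mul i j j 0 r.unop = 0
      rw [map_zero, AddMonoidHom.zero_apply]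
    smul_add := fun r a b => by
      change G.mul i j j (a + b) r.unop = G.mul i j j a r.unop + G.mul i j j b r.unop
      rw [map_add, AddMonoidHom.add_apply]
    add_smul := fun r s a => map_add (G.mul i j j a) r.unop s.unop
    zero_smul := fun a => map_zero (G.mul i j j a) }

/-- The two scalar multiplications commute, so `M i j` is an `(R i, R j)`-bimodule. -/
theorem smulComm (i j : Fin n) :
    letI := G.diagRing i
    letI := G.diagRing j
    letI := G.leftModule i j
    letI := G.rightModule i j
    SMulCommClass (G.M i i) (G.M j j)ᵐᵒᵖ (G.M i j) :=
  letI := G.diagRing i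
  letI := G.diagRing j
  letI := G.leftModule i j
  letI := G.rightModule i j
  ⟨fun r s a => (G.mul_assoc i i j j r a s.unop).symm⟩

/-- The underlying set of the generalized matrix ring: square arrays `[t i j]` with
`t i j ∈ M i j`. -/
def Mat : Type u := ∀ i j, G.M i j

/-- Componentwise addition. -/
instance : AddCommGroup G.Mat := inferInstanceAs (AddCommGroup (∀ i j, G.M i j))

/-- Row-column multiplication. -/
instance : Mul G.Mat := ⟨fun a b i k => ∑ j, G.mul i j k (a i j) (b j k)⟩

/-- The identity array: `one i` in position `(i, i)` and `0` elsewhere. -/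
instance : One G.Mat := ⟨fun i => Pi.single i (G.one i)⟩

theorem add_apply (a b : G.Mat) (i j : Fin n) : (a + b) i j = a i j + b i j := rfl

theorem neg_apply (a : G.Mat) (i j : Fin n) : (-a) i j = -a i j := rfl

theorem zero_apply (i j : Fin n) : (0 : G.Mat) i j = 0 := rfl

theorem mul_apply (a b : G.Mat) (i k : Fin n) :
    (a * b) i k = ∑ j, G.mul i j k (a i j) (b j k) := rfl

theorem one_apply_same (i : Fin n) : (1 : G.Mat) i i = G.one i :=
  Pi.single_eq_same (M := fun j => G.M i j) i (G.one i)

theorem one_apply_ne {i j : Fin n} (h : i ≠ j) : (1 : G.Mat) i j = 0 :=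
  Pi.single_eq_of_ne (M := fun j => G.M i j) h.symm (G.one i)

instance : Ring G.Mat :=
  { (inferInstance : AddCommGroup G.Mat) with
    mul_assoc := fun a b c => by
      funext i l
      simp only [mul_apply, map_sum, AddMonoidHom.finsetSum_apply, G.mul_assoc]
      exact Finset.sum_comm
    one_mul := fun a => by
      funext i k
      rw [mul_apply, Finset.sum_eq_single i]
      · rw [one_apply_same, G.one_mul]
      · intro j _ hj
        rw [one_apply_ne G hj.symm, map_zero, AddMonoidHom.zero_apply]
      · intro h
        exact absurd (Finset.mem_univ i) h
    mul_one := fun a => by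
      funext i k
      rw [mul_apply, Finset.sum_eq_single k]
      · rw [one_apply_same, G.mul_one]
      · intro j _ hj
        rw [one_apply_ne G hj, map_zero]
      · intro h
        exact absurd (Finset.mem_univ k) h
    left_distrib := fun a b c => by
      funext i k
      simp only [mul_apply, add_apply, map_add, Finset.sum_add_distrib]
    right_distrib := fun a b c => by
      funext i k
      simp only [mul_apply, add_apply, map_add, AddMonoidHom.add_apply, Finset.sum_add_distrib]
    zero_mul := fun a => by
      funext i k
      simp only [mul_apply, zero_apply, map_zero, AddMonoidHom.zero_apply, Finset.sum_const_zero]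
    mul_zero := fun a => by
      funext i k
      simp only [mul_apply, zero_apply, map_zero, Finset.sum_const_zero]
    zsmul := (inferInstance : AddCommGroup G.Mat).zsmul }

/-- Membership in the class `𝒯ₙ`: the homomorphisms `θ i j i` with `i ≠ j` vanish. -/
def IsTrivial : Prop :=
  ∀ i j, i ≠ j → ∀ (x : G.M i j) (y : G.M j i), G.mul i j i x y = 0

/-- The subring `𝒟(T)` of diagonal arrays. -/
def diagonal : Subring G.Mat where
  carrier := {t | ∀ i j, i ≠ j → t i j = 0}
  zero_mem' := fun _ _ _ => rfl
  one_mem' := fun _ _ h => one_apply_ne G h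
  add_mem' := fun {a b} ha hb i j h => by rw [add_apply, ha i j h, hb i j h, add_zero]
  neg_mem' := fun {a} ha i j h => by rw [neg_apply, ha i j h, neg_zero]
  mul_mem' := fun {a b} ha hb i k h => by
    rw [mul_apply]
    refine Finset.sum_eq_zero fun j _ => ?_
    by_cases hij : i = j
    · subst hij
      rw [hb i k h, map_zero]
    · rw [ha i j hij, map_zero, AddMonoidHom.zero_apply]

/-- `ℰₖ`: arrays with `1` in position `(k, k)`, arbitrary other entries in row `k`, and `0`
outside row `k`. -/
def rowIdempotents (k : Fin n) : Set G.Mat :=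
  {t | t k k = G.one k ∧ ∀ i j, i ≠ k → t i j = 0}

end GenMatrixData

/-- `e` is an inner Peirce trivial idempotent. -/
def IsInnerPeirceTrivial {A : Type u} [Ring A] (e : A) : Prop :=
  e * e = e ∧ ∀ x y : A, e * x * y * e = e * x * e * y * e

/-- Prime (two-sided, proper) ideals of a not necessarily commutative ring: `I * J ⊆ P` implies
`I ⊆ P` or `J ⊆ P`. -/
def IsPrimeIdeal {A : Type u} [Ring A] (P : TwoSidedIdeal A) : Prop :=
  P ≠ ⊤ ∧ ∀ I J : TwoSidedIdeal A, (∀ a ∈ I, ∀ b ∈ J, a * b ∈ P) → I ≤ P ∨ J ≤ P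

/-- A property of rings (with unity) that is invariant under isomorphism and such that a ring has
it if and only if every prime factor ring has it. -/
def IsPrimeFactorDetermined (C : ∀ (A : Type u) [Ring A], Prop) : Prop :=
  (∀ (A B : Type u) [Ring A] [Ring B], Nonempty (A ≃+* B) → C A → C B) ∧
  ∀ (A : Type u) [Ring A],
    C A ↔ ∀ P : TwoSidedIdeal A, IsPrimeIdeal P → C P.ringCon.Quotient

/-- A prime ring (not necessarily with unity); the zero ring is allowed. -/
def IsPrimeRng (A : Type u) [NonUnitalRing A] : Prop :=
  ∀ I J : TwoSidedIdeal A, (∀ a ∈ I, ∀ b ∈ J, a * b = 0) → I = ⊥ ∨ J = ⊥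

/-- An ideal meeting every nonzero ideal nontrivially. -/
def IsEssentialIdeal {A : Type u} [NonUnitalRing A] (I : TwoSidedIdeal A) : Prop :=
  ∀ J : TwoSidedIdeal A, J ≠ ⊥ → I ⊓ J ≠ ⊥

/-- A special class of rings (not necessarily with unity): an isomorphism-closed hereditary class of
prime rings that is closed under essential extensions. -/
structure IsSpecialClass (𝓜 : ∀ (A : Type u) [NonUnitalRing A], Prop) : Prop where
  iso : ∀ (A B : Type u) [NonUnitalRing A] [NonUnitalRing B], Nonempty (A ≃+* B) → 𝓜 A → 𝓜 B
  prime : ∀ (A : Type u) [NonUnitalRing A], 𝓜 A → IsPrimeRng A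
  hereditary : ∀ (A : Type u) [NonUnitalRing A] (I : TwoSidedIdeal A), 𝓜 A → 𝓜 I
  essential : ∀ (A : Type u) [NonUnitalRing A] (I : TwoSidedIdeal A),
    IsEssentialIdeal I → 𝓜 I → 𝓜 A

/-- A special radical class: the upper radical class of a special class `𝓜`, that is, the class of
all rings without nonzero homomorphic image in `𝓜`. -/
def IsSpecialRadicalClass (𝓡 : ∀ (A : Type u) [NonUnitalRing A], Prop) : Prop :=
  ∃ 𝓜 : ∀ (A : Type u) [NonUnitalRing A], Prop, IsSpecialClass 𝓜 ∧
    ∀ (A : Type u) [NonUnitalRing A],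
      𝓡 A ↔ ∀ I : TwoSidedIdeal A, 𝓜 I.ringCon.Quotient → I = ⊤

/-- The radical `ρ(A)` of `A` for a radical class `𝓡`: the sum of all ideals of `A` in `𝓡`. -/
def radicalOf (𝓡 : ∀ (A : Type u) [NonUnitalRing A], Prop) (A : Type u) [NonUnitalRing A] :
    TwoSidedIdeal A :=
  sSup {I : TwoSidedIdeal A | 𝓡 I}

/-- The set of prime ideals, ordered by inclusion. -/
abbrev PrimeSpec (A : Type u) [Ring A] : Type u := {P : TwoSidedIdeal A // IsPrimeIdeal P}

/-- The classical Krull dimension as the supremum of the lengths of chains of prime ideals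
(`⊥` for the zero ring, `⊤` if the lengths are unbounded). -/
noncomputable def classicalKrullDim (A : Type u) [Ring A] : WithBot ℕ∞ :=
  Order.krullDim (PrimeSpec A)

/-- `primeLevel A α` consists of the primes `P` such that every prime strictly containing `P` lies
in `primeLevel A β` for some `β < α`; level `0` consists of the maximal primes. -/
def primeLevel (A : Type u) [Ring A] (α : Ordinal.{u}) : Set (PrimeSpec A) :=
  {P | ∀ Q, P < Q → ∃ β, ∃ _ : β < α, Q ∈ primeLevel A β}
termination_by α

/-- The ordinal-valued classical Krull dimension of `A` exists and equals `α`: `α` is the least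
element, among `-1` (written `⊥`, with empty level) and the ordinals, whose level contains all
primes. -/
def HasOrdinalClassicalKrullDim (A : Type u) [Ring A] (α : WithBot Ordinal.{u}) : Prop :=
  IsLeast {γ : WithBot Ordinal.{u} |
    ∀ P : PrimeSpec A, ∃ β : Ordinal.{u}, (β : WithBot Ordinal.{u}) = γ ∧ P ∈ primeLevel A β} α

/-! In the product of two arrays, the summands of the (i, i) entry with j ≠ i are values of θ_iji
and vanish. Hence taking the diagonal part is a surjective homomorphism T → 𝒟(T), and it is the
identity on 𝒟(T). Its kernel lies in every prime ideal: an array with zero diagonal is a sum of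
one-entry arrays s in positions (i, j), i ≠ j, and s t s = 0 for every t, so s lies in every prime
ideal (`IsTrivial.mem_of_diagonalHom_eq_zero`).

A surjection whose kernel lies in every prime ideal identifies the ordered sets of primes
(`primeSpecOrderIso`) and the prime factor rings. This gives the statements on 𝒞 and on Krull
dimension. For a special radical it remains to know that ρ(A) is the intersection of the ideals
whose factor ring is in the special class (`IsSpecialClass.mem_radicalOf_iff`); all of these except
possibly A itself are prime. The claims on the idempotents are direct computations with entries. -/

namespace TwoSidedIdeal

/-! ### Images of ideals and isomorphism theorems, without unity -/

variable {A B : Type u} [NonUnitalRing A] [NonUnitalRing B]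

/-- The image of an ideal under a surjective homomorphism. -/
def image (f : A →ₙ+* B) (hf : Function.Surjective f) (I : TwoSidedIdeal A) : TwoSidedIdeal B :=
  .mk' (f '' I) ⟨0, I.zero_mem, map_zero f⟩
    (by
      rintro _ _ ⟨a, ha, rfl⟩ ⟨b, hb, rfl⟩
      exact ⟨a + b, I.add_mem ha hb, map_add f a b⟩)
    (by
      rintro _ ⟨a, ha, rfl⟩
      exact ⟨-a, I.neg_mem ha, map_neg f a⟩)
    (by
      rintro y _ ⟨a, ha, rfl⟩
      obtain ⟨b, rfl⟩ := hf y
      exact ⟨b * a, I.mul_mem_left b a ha, map_mul f b a⟩)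
    (by
      rintro _ y ⟨a, ha, rfl⟩
      obtain ⟨b, rfl⟩ := hf y
      exact ⟨a * b, I.mul_mem_right a b ha, map_mul f a b⟩)

theorem mem_image {f : A →ₙ+* B} {hf : Function.Surjective f} {I : TwoSidedIdeal A} {y : B} :
    y ∈ I.image f hf ↔ ∃ x ∈ I, f x = y :=
  mem_mk' ..

theorem apply_mem_image_iff {f : A →ₙ+* B} {hf : Function.Surjective f} {I : TwoSidedIdeal A}
    (hI : ∀ x, f x = 0 → x ∈ I) {x : A} : f x ∈ I.image f hf ↔ x ∈ I := by
  refine ⟨fun h => ?_, fun h => mem_image.2 ⟨x, h, rfl⟩⟩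
  obtain ⟨y, hy, hxy⟩ := mem_image.1 h
  have : x - y ∈ I := hI _ (by rw [map_sub, hxy, sub_self])
  simpa using I.add_mem this hy

/-- The projection onto a factor ring. -/
def proj (I : TwoSidedIdeal A) : A →ₙ+* I.ringCon.Quotient where
  toFun x := x
  map_zero' := rfl
  map_add' _ _ := rfl
  map_mul' _ _ := rfl

theorem proj_surjective (I : TwoSidedIdeal A) : Function.Surjective I.proj :=
  Quotient.mk''_surjective

theorem proj_eq_zero_iff {I : TwoSidedIdeal A} {x : A} : I.proj x = 0 ↔ x ∈ I :=
  I.ringCon.eq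

/-- First isomorphism theorem; the isomorphisms of factor rings below are instances of it. -/
theorem nonempty_quotient_equiv (f : A →ₙ+* B) (hf : Function.Surjective f) (I : TwoSidedIdeal A)
    (hI : ∀ x, f x = 0 ↔ x ∈ I) : Nonempty (I.ringCon.Quotient ≃+* B) := by
  have key : ∀ x y, I.ringCon x y ↔ f x = f y := fun x y => by
    rw [rel_iff, ← hI, map_sub, sub_eq_zero]
  let g : I.ringCon.Quotient → B := Quotient.lift f fun x y h => (key x y).1 h
  refine ⟨RingEquiv.mk (Equiv.ofBijective g ⟨?_, ?_⟩) ?_ ?_⟩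
  · intro x y
    obtain ⟨x, rfl⟩ := I.proj_surjective x
    obtain ⟨y, rfl⟩ := I.proj_surjective y
    exact fun h => I.ringCon.eq.2 ((key x y).2 h)
  · intro y
    obtain ⟨x, rfl⟩ := hf y
    exact ⟨I.proj x, rfl⟩
  · intro x y
    obtain ⟨x, rfl⟩ := I.proj_surjective x
    obtain ⟨y, rfl⟩ := I.proj_surjective y
    exact map_mul f x y
  · intro x y
    obtain ⟨x, rfl⟩ := I.proj_surjective x
    obtain ⟨y, rfl⟩ := I.proj_surjective y
    exact map_add f x y

theorem nonempty_quotient_comap_equiv (f : A →ₙ+* B) (hf : Function.Surjective f)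
    (P : TwoSidedIdeal B) : Nonempty ((comap f P).ringCon.Quotient ≃+* P.ringCon.Quotient) :=
  nonempty_quotient_equiv (P.proj.comp f) (P.proj_surjective.comp hf) _ fun x => by
    rw [NonUnitalRingHom.comp_apply, proj_eq_zero_iff, mem_comap]

theorem nonempty_quotient_equiv_image (f : A →ₙ+* B) (hf : Function.Surjective f)
    (P : TwoSidedIdeal A) (hP : ∀ x, f x = 0 → x ∈ P) :
    Nonempty (P.ringCon.Quotient ≃+* (P.image f hf).ringCon.Quotient) :=
  nonempty_quotient_equiv ((P.image f hf).proj.comp f) ((P.image f hf).proj_surjective.comp hf) _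
    fun x => by rw [NonUnitalRingHom.comp_apply, proj_eq_zero_iff, apply_mem_image_iff hP]

/-- The second isomorphism theorem: `I / (I ∩ ker f)` is the ideal `f(I)`. -/
theorem nonempty_restrict_quotient_equiv (f : A →ₙ+* B) (hf : Function.Surjective f)
    (I : TwoSidedIdeal A) (J : TwoSidedIdeal I) (hJ : ∀ x : I, f (x : A) = 0 ↔ x ∈ J) :
    Nonempty (J.ringCon.Quotient ≃+* I.image f hf) :=
  nonempty_quotient_equiv
    { toFun := fun x : I => (⟨f (x : A), mem_image.2 ⟨(x : A), x.2, rfl⟩⟩ : I.image f hf)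
      map_zero' := Subtype.ext (map_zero f)
      map_add' := fun x y => Subtype.ext (map_add f (x : A) y)
      map_mul' := fun x y => Subtype.ext (map_mul f (x : A) y) }
    (by
      rintro ⟨y, hy⟩
      obtain ⟨x, hx, rfl⟩ := mem_image.1 hy
      exact ⟨⟨x, hx⟩, rfl⟩)
    J fun x => by
      rw [← hJ x]
      exact Subtype.ext_iff

theorem image_eq_bot_iff {f : A →ₙ+* B} {hf : Function.Surjective f} {I : TwoSidedIdeal A} :
    I.image f hf = ⊥ ↔ ∀ x ∈ I, f x = 0 := by
  constructor
  · intro h x hx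
    have : f x ∈ I.image f hf := mem_image.2 ⟨x, hx, rfl⟩
    rwa [h, mem_bot] at this
  · intro h
    refine le_bot_iff.1 fun y hy => ?_
    obtain ⟨x, hx, rfl⟩ := mem_image.1 hy
    exact (mem_bot _).2 (h x hx)

end TwoSidedIdeal

open TwoSidedIdeal

/-! ### Special classes and their radicals -/

section Special

variable {A B : Type u} [NonUnitalRing A] [NonUnitalRing B]

theorem IsPrimeRng.le_or_le {P : TwoSidedIdeal A} (hP : IsPrimeRng P.ringCon.Quotient)
    {I J : TwoSidedIdeal A} (h : ∀ a ∈ I, ∀ b ∈ J, a * b ∈ P) : I ≤ P ∨ J ≤ P := by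
  have key : ∀ I : TwoSidedIdeal A, I.image P.proj P.proj_surjective = ⊥ → I ≤ P :=
    fun I hI x hx => proj_eq_zero_iff.1 (image_eq_bot_iff.1 hI x hx)
  refine (hP (I.image P.proj P.proj_surjective) (J.image P.proj P.proj_surjective) ?_).imp
    (key I) (key J)
  intro x hx y hy
  obtain ⟨a, ha, rfl⟩ := mem_image.1 hx
  obtain ⟨b, hb, rfl⟩ := mem_image.1 hy
  rw [← map_mul]
  exact proj_eq_zero_iff.2 (h a ha b hb)

/-- Replaces multiplication by 1: the elements a with aA ⊆ J form an ideal L with LA ⊆ J, and A is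
not contained in J, so primeness gives L ≤ J. -/
theorem IsPrimeRng.mem_of_mul_right {J : TwoSidedIdeal A} (hJ : IsPrimeRng J.ringCon.Quotient)
    (hne : J ≠ ⊤) {x : A} (h : ∀ y, x * y ∈ J) : x ∈ J := by
  let L : TwoSidedIdeal A := .mk' {x | ∀ y, x * y ∈ J}
    (fun y => by rw [zero_mul]; exact J.zero_mem)
    (fun ha hb y => by rw [add_mul]; exact J.add_mem (ha y) (hb y))
    (fun ha y => by rw [neg_mul]; exact J.neg_mem (ha y))
    (fun ha y => by rw [mul_assoc]; exact J.mul_mem_left _ _ (ha y))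
    (fun ha y => by rw [mul_assoc]; exact ha _)
  have hL : ∀ {a}, a ∈ L ↔ ∀ y, a * y ∈ J := mem_mk' ..
  rcases hJ.le_or_le (I := L) (J := ⊤) fun a ha b _ => hL.1 ha b with h' | h'
  · exact h' (hL.2 h)
  · exact absurd (top_le_iff.1 h') hne

theorem IsPrimeRng.mem_of_mul_left {J : TwoSidedIdeal A} (hJ : IsPrimeRng J.ringCon.Quotient)
    (hne : J ≠ ⊤) {x : A} (h : ∀ y, y * x ∈ J) : x ∈ J := by
  let L : TwoSidedIdeal A := .mk' {x | ∀ y, y * x ∈ J}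
    (fun y => by rw [mul_zero]; exact J.zero_mem)
    (fun ha hb y => by rw [mul_add]; exact J.add_mem (ha y) (hb y))
    (fun ha y => by rw [mul_neg]; exact J.neg_mem (ha y))
    (fun ha y => by rw [← mul_assoc]; exact ha _)
    (fun ha y => by rw [← mul_assoc]; exact J.mul_mem_right _ _ (ha y))
  have hL : ∀ {a}, a ∈ L ↔ ∀ y, y * a ∈ J := mem_mk' ..
  rcases hJ.le_or_le (I := ⊤) (J := L) fun a _ b hb => hL.1 hb a with h' | h'
  · exact absurd (top_le_iff.1 h') hne
  · exact h' (hL.2 h)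

variable {𝓜 : ∀ (A : Type u) [NonUnitalRing A], Prop}

/-- If an ideal `K` of `A` has a proper ideal `J` with `K / J` in a special class, then `A` has an
ideal `Q` with `A / Q` in the special class and `Q ∩ K = J`. -/
theorem IsSpecialClass.exists_extension (h𝓜 : IsSpecialClass 𝓜) (K : TwoSidedIdeal A)
    (J : TwoSidedIdeal K) (hJ : 𝓜 J.ringCon.Quotient) (hne : J ≠ ⊤) :
    ∃ Q : TwoSidedIdeal A, 𝓜 Q.ringCon.Quotient ∧ ∀ x : K, (x : A) ∈ Q ↔ x ∈ J := by
  have hp := h𝓜.prime _ hJ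
  -- `J` is only an ideal of `K`. It absorbs `A` from the left because y(ax) = (ya)x with ya ∈ K,
  -- and the factor y ∈ K can be cancelled modulo `J`.
  have hleft : ∀ (a : A) (x : K), x ∈ J →
      (⟨a * x, K.mul_mem_left _ _ x.2⟩ : K) ∈ J := fun a x hx =>
    hp.mem_of_mul_left hne fun y => by
      have := J.mul_mem_left ⟨y * a, K.mul_mem_right _ _ y.2⟩ x hx
      convert this using 1
      exact Subtype.ext (mul_assoc (y : A) a x).symm
  -- `Q` consists of all a with aK ⊆ J.
  let Q : TwoSidedIdeal A := .mk' {a | ∀ k : K, (⟨a * k, K.mul_mem_left _ _ k.2⟩ : K) ∈ J}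
    (fun k => by
      convert J.zero_mem using 1
      exact Subtype.ext (zero_mul (k : A)))
    (fun {a b} ha hb k => by
      convert J.add_mem (ha k) (hb k) using 1
      exact Subtype.ext (add_mul a b (k : A)))
    (fun {a} ha k => by
      convert J.neg_mem (ha k) using 1
      exact Subtype.ext (neg_mul a (k : A)))
    (fun {a b} hb k => by
      convert hleft a _ (hb k) using 1
      exact Subtype.ext (mul_assoc a b (k : A)))
    (fun {a b} ha k => by
      convert ha ⟨b * k, K.mul_mem_left _ _ k.2⟩ using 1
      exact Subtype.ext (mul_assoc a b (k : A)))
  have hQ : ∀ {a}, a ∈ Q ↔ ∀ k : K, (⟨a * k, K.mul_mem_left _ _ k.2⟩ : K) ∈ J := mem_mk' ..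
  have hQK : ∀ x : K, (x : A) ∈ Q ↔ x ∈ J := fun x =>
    ⟨fun h => hp.mem_of_mul_right hne fun y => hQ.1 h y,
      fun h => hQ.2 fun k => J.mul_mem_right x k h⟩
  -- The image of `K` in A/Q is isomorphic to K/J. It is essential: if the class of w lies in an
  -- ideal `W` that meets this image trivially, then wk ∈ Q ∩ K = J for all k ∈ K, so w ∈ Q.
  refine ⟨Q, h𝓜.essential _ (K.image Q.proj Q.proj_surjective) ?_ ?_, hQK⟩
  · intro W hW hKW
    refine hW (le_bot_iff.1 fun y hy => ?_)
    obtain ⟨w, rfl⟩ := Q.proj_surjective y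
    refine (mem_bot _).2 (proj_eq_zero_iff.2 (hQ.2 fun k => (hQK _).1 ?_))
    rw [← proj_eq_zero_iff, ← mem_bot, ← hKW, mem_inf]
    refine ⟨mem_image.2 ⟨_, K.mul_mem_left _ _ k.2, rfl⟩, ?_⟩
    rw [map_mul]
    exact W.mul_mem_right _ _ hy
  · obtain ⟨e⟩ := nonempty_restrict_quotient_equiv Q.proj Q.proj_surjective K J fun x => by
      rw [proj_eq_zero_iff, hQK]
    exact h𝓜.iso _ _ ⟨e⟩ hJ

/-- A special radical is the intersection of the ideals whose factor rings are in the special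
class. -/
theorem IsSpecialClass.mem_radicalOf_iff (h𝓜 : IsSpecialClass 𝓜)
    {𝓡 : ∀ (A : Type u) [NonUnitalRing A], Prop}
    (h𝓡 : ∀ (A : Type u) [NonUnitalRing A],
      𝓡 A ↔ ∀ I : TwoSidedIdeal A, 𝓜 I.ringCon.Quotient → I = ⊤) {x : A} :
    x ∈ radicalOf 𝓡 A ↔ ∀ P : TwoSidedIdeal A, 𝓜 P.ringCon.Quotient → x ∈ P := by
  constructor
  · intro hx P hP
    suffices h : radicalOf 𝓡 A ≤ P from h hx
    refine sSup_le fun I hI y hy => ?_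
    -- J = I ∩ P, and I/J is isomorphic to an ideal of A/P, so it is in `𝓜` by heredity; as `I` is
    -- radical, J = I.
    let J : TwoSidedIdeal I := .mk' {z | (z : A) ∈ P} P.zero_mem (fun h h' => P.add_mem h h')
      (fun h => P.neg_mem h) (fun h => P.mul_mem_left _ _ h) (fun h => P.mul_mem_right _ _ h)
    have hJ : ∀ z : I, z ∈ J ↔ (z : A) ∈ P := fun z => mem_mk' ..
    obtain ⟨e⟩ := nonempty_restrict_quotient_equiv P.proj P.proj_surjective I J fun z => by
      rw [proj_eq_zero_iff, hJ]
    have hJtop := (h𝓡 I).1 hI J (h𝓜.iso _ _ ⟨e.symm⟩ (h𝓜.hereditary _ _ hP))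
    exact (hJ ⟨y, hy⟩).1 (hJtop ▸ mem_top _)
  · intro hx
    -- The intersection `K` is itself radical: a proper `J` with K/J in `𝓜` would extend to some `Q`
    -- with Q ∩ K = J, whereas K ≤ Q by definition of `K`.
    let K : TwoSidedIdeal A := sInf {P | 𝓜 P.ringCon.Quotient}
    have hxK : x ∈ K := (mem_sInf _).2 fun P hP => hx P hP
    suffices h : 𝓡 K from le_sSup (a := K) h hxK
    refine (h𝓡 K).2 fun J hJ => ?_
    by_contra hne
    obtain ⟨Q, hQ, hQK⟩ := h𝓜.exists_extension K J hJ hne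
    exact hne (top_le_iff.1 fun z _ => (hQK z).1 ((mem_sInf _).1 z.2 Q hQ))

end Special

/-! ### Prime ideals along a surjection with kernel in every prime -/

section PrimeIdeals

variable {A B : Type u} [Ring A] [Ring B]

/-- Elementwise semiprimeness: aAa ⊆ P passes to (a)A(a) ⊆ P by induction on the right and then the
left generator. The free middle factor t absorbs the multipliers that appear next to it; t = 1
finally gives (a)(a) ⊆ P. -/
theorem IsPrimeIdeal.mem_of_mul_mul_mem {P : TwoSidedIdeal A} (hP : IsPrimeIdeal P) {a : A}
    (h : ∀ t, a * t * a ∈ P) : a ∈ P := by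
  have h₁ : ∀ b ∈ span {a}, ∀ t, a * t * b ∈ P := fun b hb => by
    induction hb using span_induction with
    | mem x hx => rw [Set.mem_singleton_iff.1 hx]; exact h
    | zero => intro t; rw [mul_zero]; exact P.zero_mem
    | add x y _ _ hx hy => intro t; rw [mul_add]; exact P.add_mem (hx t) (hy t)
    | neg x _ hx => intro t; rw [mul_neg]; exact P.neg_mem (hx t)
    | left_absorb c x _ hx => intro t; rw [← mul_assoc, mul_assoc a t c]; exact hx _
    | right_absorb c x _ hx => intro t; rw [← mul_assoc]; exact P.mul_mem_right _ _ (hx t)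
  have h₂ : ∀ c ∈ span {a}, ∀ t, ∀ b ∈ span {a}, c * t * b ∈ P := fun c hc => by
    induction hc using span_induction with
    | mem x hx => rw [Set.mem_singleton_iff.1 hx]; exact fun t b hb => h₁ b hb t
    | zero => intro t b _; rw [zero_mul, zero_mul]; exact P.zero_mem
    | add x y _ _ hx hy =>
      intro t b hb; rw [add_mul, add_mul]; exact P.add_mem (hx t b hb) (hy t b hb)
    | neg x _ hx => intro t b hb; rw [neg_mul, neg_mul]; exact P.neg_mem (hx t b hb)
    | left_absorb c x _ hx =>
      intro t b hb; rw [mul_assoc, mul_assoc, ← mul_assoc x]; exact P.mul_mem_left _ _ (hx t b hb)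
    | right_absorb c x _ hx => intro t b hb; rw [mul_assoc x c t]; exact hx _ b hb
  have ha : a ∈ span {a} := subset_span rfl
  rcases hP.2 (span {a}) (span {a}) fun x hx y hy => by simpa using h₂ x hx 1 y hy with h' | h' <;>
    exact h' ha

theorem isPrimeIdeal_of_isPrimeRng {P : TwoSidedIdeal A} (hP : IsPrimeRng P.ringCon.Quotient)
    (hne : P ≠ ⊤) : IsPrimeIdeal P :=
  ⟨hne, fun _ _ h => hP.le_or_le h⟩

variable {f : A →ₙ+* B} (hf : Function.Surjective f)

include hf in
theorem IsPrimeIdeal.comap_of_surjective {P : TwoSidedIdeal B} (hP : IsPrimeIdeal P) :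
    IsPrimeIdeal (comap f P) := by
  refine ⟨fun h => hP.1 (top_le_iff.1 fun y _ => ?_), fun I J h => ?_⟩
  · obtain ⟨x, rfl⟩ := hf y
    exact (mem_comap f).1 (h ▸ mem_top _)
  · have key : ∀ I : TwoSidedIdeal A, I.image f hf ≤ P → I ≤ comap f P := fun I hI x hx =>
      (mem_comap f).2 (hI (mem_image.2 ⟨x, hx, rfl⟩))
    refine (hP.2 (I.image f hf) (J.image f hf) ?_).imp (key I) (key J)
    intro x hx y hy
    obtain ⟨a, ha, rfl⟩ := mem_image.1 hx
    obtain ⟨b, hb, rfl⟩ := mem_image.1 hy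
    rw [← map_mul]
    exact (mem_comap f).1 (h a ha b hb)

theorem IsPrimeIdeal.image {P : TwoSidedIdeal A} (hP : IsPrimeIdeal P)
    (hker : ∀ x, f x = 0 → x ∈ P) : IsPrimeIdeal (P.image f hf) := by
  refine ⟨fun h => hP.1 (top_le_iff.1 fun x _ => ?_), fun I J h => ?_⟩
  · exact (apply_mem_image_iff hker (hf := hf)).1 (h ▸ mem_top _)
  · have key : ∀ I : TwoSidedIdeal B, comap f I ≤ P → I ≤ P.image f hf := fun I hI y hy => by
      obtain ⟨x, rfl⟩ := hf y
      exact mem_image.2 ⟨x, hI ((mem_comap f).2 hy), rfl⟩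
    refine (hP.2 (comap f I) (comap f J) ?_).imp (key I) (key J)
    intro a ha b hb
    rw [← apply_mem_image_iff hker (hf := hf), map_mul]
    exact h _ ((mem_comap f).1 ha) _ ((mem_comap f).1 hb)

variable (hker : ∀ P : TwoSidedIdeal A, IsPrimeIdeal P → ∀ x, f x = 0 → x ∈ P)

/-- A surjective homomorphism whose kernel lies in every prime ideal induces an isomorphism of prime
spectra. -/
def primeSpecOrderIso : PrimeSpec A ≃o PrimeSpec B where
  toFun P := ⟨P.1.image f hf, P.2.image hf (hker P.1 P.2)⟩
  invFun P := ⟨comap f P.1, P.2.comap_of_surjective hf⟩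
  left_inv P := Subtype.ext <| TwoSidedIdeal.ext fun x => by
    rw [mem_comap, apply_mem_image_iff (hker P.1 P.2)]
  right_inv P := Subtype.ext <| TwoSidedIdeal.ext fun y => by
    obtain ⟨x, rfl⟩ := hf y
    rw [apply_mem_image_iff fun z hz => (mem_comap f).2 (hz ▸ P.1.zero_mem), mem_comap]
  map_rel_iff' {P Q} := by
    refine ⟨fun h x hx => ?_, fun h y hy => ?_⟩
    · exact (apply_mem_image_iff (hf := hf) (hker Q.1 Q.2)).1
        (h ((mem_image (hf := hf)).2 ⟨x, hx, rfl⟩))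
    · obtain ⟨x, hx, rfl⟩ := (mem_image (hf := hf)).1 hy
      exact (mem_image (hf := hf)).2 ⟨x, h hx, rfl⟩

theorem mem_primeLevel_orderIso_iff (e : PrimeSpec A ≃o PrimeSpec B) (α : Ordinal.{u})
    (P : PrimeSpec A) : e P ∈ primeLevel B α ↔ P ∈ primeLevel A α := by
  induction α using WellFoundedLT.induction generalizing P with
  | ind α ih =>
    rw [primeLevel, primeLevel]
    constructor
    · intro h Q hPQ
      obtain ⟨β, hβ, hQ⟩ := h (e Q) (e.lt_iff_lt.2 hPQ)
      exact ⟨β, hβ, (ih β hβ Q).1 hQ⟩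
    · intro h Q hPQ
      obtain ⟨Q, rfl⟩ := e.surjective Q
      obtain ⟨β, hβ, hQ⟩ := h Q (e.lt_iff_lt.1 hPQ)
      exact ⟨β, hβ, (ih β hβ Q).2 hQ⟩

theorem hasOrdinalClassicalKrullDim_iff_of_orderIso (e : PrimeSpec A ≃o PrimeSpec B)
    (α : WithBot Ordinal.{u}) :
    HasOrdinalClassicalKrullDim B α ↔ HasOrdinalClassicalKrullDim A α := by
  unfold HasOrdinalClassicalKrullDim
  simp only [e.surjective.forall, mem_primeLevel_orderIso_iff]

include hf hker

theorem IsPrimeFactorDetermined.iff_of_surjective {C : ∀ (A : Type u) [Ring A], Prop}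
    (hC : IsPrimeFactorDetermined C) : C B ↔ C A := by
  rw [hC.2 A, hC.2 B]
  constructor
  · intro h P hP
    obtain ⟨e⟩ := nonempty_quotient_equiv_image f hf P (hker P hP)
    exact hC.1 _ _ ⟨e.symm⟩ (h _ (hP.image hf (hker P hP)))
  · intro h P hP
    obtain ⟨e⟩ := nonempty_quotient_comap_equiv f hf P
    exact hC.1 _ _ ⟨e⟩ (h _ (hP.comap_of_surjective hf))

theorem IsSpecialRadicalClass.apply_mem_radicalOf_iff
    {𝓡 : ∀ (A : Type u) [NonUnitalRing A], Prop} (h𝓡 : IsSpecialRadicalClass 𝓡) (x : A) :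
    f x ∈ radicalOf 𝓡 B ↔ x ∈ radicalOf 𝓡 A := by
  obtain ⟨𝓜, h𝓜, h⟩ := h𝓡
  rw [h𝓜.mem_radicalOf_iff h, h𝓜.mem_radicalOf_iff h]
  constructor
  · intro hx P hP
    -- The special class may contain the zero ring, so P = A has to be split off before primeness is
    -- available.
    by_cases hne : P = ⊤
    · exact hne ▸ mem_top _
    have hPker := hker P (isPrimeIdeal_of_isPrimeRng (h𝓜.prime _ hP) hne)
    obtain ⟨e⟩ := nonempty_quotient_equiv_image f hf P hPker
    exact (apply_mem_image_iff hPker).1 (hx _ (h𝓜.iso _ _ ⟨e⟩ hP))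
  · intro hx P hP
    obtain ⟨e⟩ := nonempty_quotient_comap_equiv f hf P
    exact (mem_comap f).1 (hx _ (h𝓜.iso _ _ ⟨e.symm⟩ hP))

end PrimeIdeals

/-! ### Entry computations in the generalized matrix ring -/

namespace GenMatrixData

variable {n : ℕ} (T : GenMatrixData.{u} n)

@[ext]
theorem mat_ext {a b : T.Mat} (h : ∀ i j, a i j = b i j) : a = b :=
  funext fun i => funext fun j => h i j

theorem sum_apply {ι : Type*} (s : Finset ι) (a : ι → T.Mat) (i j : Fin n) :
    (∑ k ∈ s, a k) i j = ∑ k ∈ s, a k i j := by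
  classical
  induction s using Finset.induction_on with
  | empty => rfl
  | insert k s hk ih => rw [Finset.sum_insert hk, Finset.sum_insert hk, add_apply, ih]

/-- The array with `m` in position `(i, j)` and `0` elsewhere. -/
def single (i j : Fin n) (m : T.M i j) : T.Mat :=
  Pi.single (M := fun i => ∀ j, T.M i j) i (Pi.single (M := fun j => T.M i j) j m)

theorem single_apply_same (i j : Fin n) (m : T.M i j) : T.single i j m i j = m := by
  rw [single, Pi.single_eq_same, Pi.single_eq_same]

theorem single_apply_of_row_ne {i j k l : Fin n} (m : T.M i j) (h : k ≠ i) :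
    T.single i j m k l = 0 := by
  rw [single, Pi.single_eq_of_ne h]
  rfl

theorem single_apply_of_col_ne {i j l : Fin n} (m : T.M i j) (h : l ≠ j) :
    T.single i j m i l = 0 := by
  rw [single, Pi.single_eq_same, Pi.single_eq_of_ne h]

theorem sum_single (t : T.Mat) : ∑ i, ∑ j, T.single i j (t i j) = t := by
  ext k l
  rw [sum_apply, Finset.sum_eq_single k, sum_apply, Finset.sum_eq_single l, single_apply_same]
  · exact fun j _ hj => T.single_apply_of_col_ne _ hj.symm
  · exact fun h => absurd (Finset.mem_univ _) h
  · intro i _ hi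
    rw [sum_apply]
    exact Finset.sum_eq_zero fun j _ => T.single_apply_of_row_ne _ hi.symm
  · exact fun h => absurd (Finset.mem_univ _) h

variable {T}

theorem IsTrivial.mul_apply_diag (hT : T.IsTrivial) (a b : T.Mat) (i : Fin n) :
    (a * b) i i = T.mul i i i (a i i) (b i i) := by
  rw [mul_apply, Finset.sum_eq_single i]
  · exact fun j _ hj => hT i j hj.symm _ _
  · exact fun h => absurd (Finset.mem_univ _) h

/-- The only entry of the product that could survive is (m t_ji) m in position (i, j), and m t_ji is
a value of θ_iji. -/
theorem IsTrivial.single_mul_mul_single (hT : T.IsTrivial) {i j : Fin n} (h : i ≠ j)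
    (m : T.M i j) (t : T.Mat) : T.single i j m * t * T.single i j m = 0 := by
  ext k l
  rw [mul_apply]
  refine Finset.sum_eq_zero fun p _ => ?_
  by_cases hp : p = i
  · subst hp
    suffices h0 : (T.single p j m * t) k p = 0 by rw [h0, map_zero, AddMonoidHom.zero_apply]
    rw [mul_apply]
    refine Finset.sum_eq_zero fun q _ => ?_
    by_cases hk : k = p
    · subst hk
      by_cases hq : q = j
      · subst hq
        exact hT _ _ h _ _
      · rw [T.single_apply_of_col_ne _ hq, map_zero, AddMonoidHom.zero_apply]
    · rw [T.single_apply_of_row_ne _ hk, map_zero, AddMonoidHom.zero_apply]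
  · rw [T.single_apply_of_row_ne _ hp, map_zero]

/-- Row k of eze depends on z only through z_kk. Both halves of inner Peirce triviality follow: z =
1 gives e² = e, and xy and xey have the same (k, k) entry because diagonal entries multiply and e_kk
= 1. -/
theorem mul_mul_apply_of_mem_rowIdempotents (hT : T.IsTrivial) {k : Fin n} {e : T.Mat}
    (he : e ∈ T.rowIdempotents k) (z : T.Mat) (j : Fin n) :
    (e * z * e) k j = T.mul k k j (z k k) (e k j) := by
  rw [mul_apply, Finset.sum_eq_single k, hT.mul_apply_diag, he.1, T.one_mul]
  · intro l _ hl
    rw [he.2 l j hl, map_zero]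
  · exact fun h => absurd (Finset.mem_univ _) h

theorem mul_apply_of_mem_rowIdempotents {k i : Fin n} {e : T.Mat} (he : e ∈ T.rowIdempotents k)
    (hi : i ≠ k) (z : T.Mat) (j : Fin n) : (e * z) i j = 0 := by
  rw [mul_apply]
  exact Finset.sum_eq_zero fun l _ => by rw [he.2 i l hi, map_zero, AddMonoidHom.zero_apply]

theorem isInnerPeirceTrivial_of_mem_rowIdempotents (hT : T.IsTrivial) {k : Fin n} {e : T.Mat}
    (he : e ∈ T.rowIdempotents k) : IsInnerPeirceTrivial e := by
  constructor
  · have h := mul_mul_apply_of_mem_rowIdempotents hT he 1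
    rw [_root_.mul_one] at h
    ext i j
    by_cases hi : i = k
    · subst hi
      rw [h j, one_apply_same, T.one_mul]
    · rw [mul_apply_of_mem_rowIdempotents he hi, he.2 i j hi]
  · intro x y
    rw [_root_.mul_assoc e x y, show e * x * e * y = e * (x * e * y) by simp only [_root_.mul_assoc]]
    ext i j
    by_cases hi : i = k
    · subst hi
      rw [mul_mul_apply_of_mem_rowIdempotents hT he, mul_mul_apply_of_mem_rowIdempotents hT he,
        hT.mul_apply_diag, hT.mul_apply_diag, hT.mul_apply_diag, he.1, T.mul_one]
    · rw [_root_.mul_assoc, mul_apply_of_mem_rowIdempotents he hi, _root_.mul_assoc,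
        mul_apply_of_mem_rowIdempotents he hi]

theorem single_diag_mem_diagonal (i : Fin n) (m : T.M i i) : T.single i i m ∈ T.diagonal := by
  intro k l h
  by_cases hk : k = i
  · subst hk
    exact T.single_apply_of_col_ne _ h.symm
  · exact T.single_apply_of_row_ne _ hk

theorem single_add_single_mem_rowIdempotents {i j : Fin n} (h : i ≠ j) (m : T.M i j) :
    T.single i i (T.one i) + T.single i j m ∈ T.rowIdempotents i := by
  refine ⟨?_, fun k l hk => ?_⟩
  · rw [add_apply, single_apply_same, T.single_apply_of_col_ne _ h, add_zero]
  · rw [add_apply, T.single_apply_of_row_ne _ hk, T.single_apply_of_row_ne _ hk, add_zero]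

variable (T) in
-- An off-diagonal one-entry array is the difference of an element of ℰᵢ and the diagonal idempotent
-- with 1 in position (i, i).
theorem closure_diagonal_union_rowIdempotents :
    Subring.closure ((T.diagonal : Set T.Mat) ∪ ⋃ k, T.rowIdempotents k) = ⊤ := by
  refine (Subring.eq_top_iff' _).2 fun t => ?_
  rw [← T.sum_single t]
  refine sum_mem fun i _ => sum_mem fun j _ => ?_
  have hdiag : ∀ m, T.single i i m ∈ Subring.closure
      ((T.diagonal : Set T.Mat) ∪ ⋃ k, T.rowIdempotents k) := fun m =>
    Subring.subset_closure (Or.inl (single_diag_mem_diagonal i m))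
  by_cases h : i = j
  · subst h
    exact hdiag _
  · have hrow : T.single i i (T.one i) + T.single i j (t i j) ∈ Subring.closure
        ((T.diagonal : Set T.Mat) ∪ ⋃ k, T.rowIdempotents k) :=
      Subring.subset_closure (Or.inr (Set.mem_iUnion.2
        ⟨i, single_add_single_mem_rowIdempotents h (t i j)⟩))
    simpa using sub_mem hrow (hdiag (T.one i))

/-! ### The projection onto the diagonal and its kernel -/

variable (T) in
/-- The diagonal part of an array. -/
def diagonalPart (t : T.Mat) : T.Mat :=
  fun i => Pi.single (M := fun j => T.M i j) i (t i i)

variable (T) in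
theorem diagonalPart_mem (t : T.Mat) : T.diagonalPart t ∈ T.diagonal := fun i _ h =>
  Pi.single_eq_of_ne (M := fun j => T.M i j) (Ne.symm h) (t i i)

/-- The projection of `T` onto its diagonal, a homomorphism if `T ∈ 𝒯ₙ`. -/
def IsTrivial.diagonalHom (hT : T.IsTrivial) : T.Mat →ₙ+* T.diagonal where
  toFun t := ⟨T.diagonalPart t, T.diagonalPart_mem t⟩
  map_zero' := Subtype.ext <| mat_ext T fun i j => congrFun (Pi.single_zero i) j
  map_add' a b := Subtype.ext <| mat_ext T fun i j =>
    congrFun (Pi.single_add (f := fun j => T.M i j) i (a i i) (b i i)) j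
  map_mul' a b := Subtype.ext <| mat_ext T fun i j => by
    by_cases h : i = j
    · subst h
      refine (Pi.single_eq_same (M := fun j => T.M i j) i _).trans ((hT.mul_apply_diag a b i).trans
        (Eq.trans ?_ (hT.mul_apply_diag _ _ i).symm))
      exact congrArg₂ (fun x y => T.mul i i i x y)
        (Pi.single_eq_same (M := fun j => T.M i j) i _).symm
        (Pi.single_eq_same (M := fun j => T.M i j) i _).symm
    · exact (Pi.single_eq_of_ne (M := fun j => T.M i j) (Ne.symm h) _).trans
        ((T.diagonal.mul_mem (T.diagonalPart_mem a) (T.diagonalPart_mem b)) i j h).symm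

theorem IsTrivial.diagonalHom_coe (hT : T.IsTrivial) (t : T.diagonal) :
    hT.diagonalHom (t : T.Mat) = t := by
  refine Subtype.ext <| mat_ext T fun i j => ?_
  by_cases h : i = j
  · subst h
    exact Pi.single_eq_same (M := fun j => T.M i j) i _
  · exact (Pi.single_eq_of_ne (M := fun j => T.M i j) (Ne.symm h) _).trans (t.2 i j h).symm

theorem IsTrivial.diagonalHom_surjective (hT : T.IsTrivial) :
    Function.Surjective hT.diagonalHom :=
  fun t => ⟨t, hT.diagonalHom_coe t⟩

theorem IsTrivial.mem_of_diagonalHom_eq_zero (hT : T.IsTrivial) {P : TwoSidedIdeal T.Mat}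
    (hP : IsPrimeIdeal P) {t : T.Mat} (ht : hT.diagonalHom t = 0) : t ∈ P := by
  rw [← T.sum_single t]
  -- Each one-entry summand s is put into `P` separately, through s x s ∈ P for all x; for i = j the
  -- summand is 0.
  refine sum_mem fun i _ => sum_mem fun j _ => hP.mem_of_mul_mul_mem fun x => ?_
  by_cases h : i = j
  · subst h
    have h0 : (hT.diagonalHom t : T.Mat) i i = 0 := by rw [ht]; rfl
    have h1 : t i i = 0 := (Pi.single_eq_same (M := fun j => T.M i j) i _).symm.trans h0
    have h2 : T.single i i (t i i) = 0 := by
      rw [h1, single, Pi.single_zero, Pi.single_zero]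
      rfl
    rw [h2, mul_zero]
    exact P.zero_mem
  · rw [hT.single_mul_mul_single h]
    exact P.zero_mem

end GenMatrixData

theorem theorem1p16 (n : ℕ) (hn : 1 < n) (T : GenMatrixData.{u} n) (hT : T.IsTrivial) :
    -- the explicit idempotents are inner Peirce trivial, and with the diagonal they generate `T`
    ((∀ k, ∀ e ∈ T.rowIdempotents k, IsInnerPeirceTrivial e) ∧
      Subring.closure ((T.diagonal : Set T.Mat) ∪ ⋃ k, T.rowIdempotents k) = ⊤) ∧
    -- properties determined by prime factors
    (∀ C : ∀ (A : Type u) [Ring A], Prop, IsPrimeFactorDetermined C →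
      (C T.diagonal ↔ C T.Mat)) ∧
    -- special radicals
    (∀ 𝓡 : ∀ (A : Type u) [NonUnitalRing A], Prop, IsSpecialRadicalClass 𝓡 →
      (Subtype.val '' (radicalOf 𝓡 T.diagonal : Set T.diagonal) : Set T.Mat) =
        (radicalOf 𝓡 T.Mat : Set T.Mat) ∩ (T.diagonal : Set T.Mat)) ∧
    -- classical Krull dimension, by lengths of chains and as an ordinal
    (classicalKrullDim T.diagonal = classicalKrullDim T.Mat ∧
      ∀ α : WithBot Ordinal.{u},
        HasOrdinalClassicalKrullDim T.diagonal α ↔ HasOrdinalClassicalKrullDim T.Mat α) := by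
  have hker : ∀ P : TwoSidedIdeal T.Mat, IsPrimeIdeal P → ∀ x, hT.diagonalHom x = 0 → x ∈ P :=
    fun P hP x hx => hT.mem_of_diagonalHom_eq_zero hP hx
  have hsurj := hT.diagonalHom_surjective
  have e := primeSpecOrderIso hsurj hker
  refine ⟨⟨fun k e he => GenMatrixData.isInnerPeirceTrivial_of_mem_rowIdempotents hT he,
    T.closure_diagonal_union_rowIdempotents⟩, fun C hC => hC.iff_of_surjective hsurj hker,
    fun 𝓡 h𝓡 => ?_, (Order.krullDim_eq_of_orderIso e).symm,
    hasOrdinalClassicalKrullDim_iff_of_orderIso e⟩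
  -- Since the projection fixes 𝒟(T), transferring the radical along it compares the membership of
  -- the same element t in both radicals.
  have key (t : T.diagonal) : t ∈ radicalOf 𝓡 T.diagonal ↔ (t : T.Mat) ∈ radicalOf 𝓡 T.Mat := by
    rw [← h𝓡.apply_mem_radicalOf_iff hsurj hker, hT.diagonalHom_coe]
  ext x
  constructor
  · rintro ⟨t, ht, rfl⟩
    exact ⟨(key t).1 ht, t.2⟩
  · rintro ⟨hx, hx'⟩
    exact ⟨⟨x, hx'⟩, (key ⟨x, hx'⟩).2 hx, rfl⟩
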